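/- For a finite simple graph $G$ with vertex set $V$, let $P_G=\operatorname{conv}\{\pm(e_i-e_j):\{i,j\}\in E(G)\}\subset\mathbb{R}^V$ be its symmetric edge polytope, and let $N(G)$ be the number of facets of $P_G$. Let $C_m$ denote the cycle with $m$ vertices for $m\ge 3$, let $C_1$ denote a single vertex, let $e$ denote the graph consisting of a single edge, and let $G\vee H$ denote a graph obtained by identifying a vertex of $G$ with a vertex of $H$ (the number $N(G\vee H)$ does not depend on the choice of these vertices in the graphs below). For $n\ge 3$ let $M(n)=N(G_n)$, where \[ G_n=\begin{cases} C_{k+1}\vee C_{k-1} & n=2k-1,\ k\text{ even},\\ C_k\vee C_k & n=2k-1,\ k\text{ odd},\\ C_{k+1}\vee C_{k-1}\vee e & n=2k,\ k\text{ even},\\ C_k\vee C_k\vee e & n=2k,\ k\text{ odd}. \end{cases} \] Let $n\ge 3$. If $N(G)\le M(n)$ for every connected graph $G$ with $n$ vertices and $n+1$ edges, then $N(G)\le M(n+1)$ for every connected graph $G$ with $n+1$ vertices and $n+2$ edges that has at least one leaf (a vertex of degree one). -/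

import Mathlib

namespace SymmetricEdge

/-- The symmetric edge polytope `P_G = conv {±(e_i - e_j) : {i,j} ∈ E(G)}` in `ℝ^V`.
Both signs are present because adjacency is symmetric. -/
def polytope {V : Type*} [DecidableEq V] (G : SimpleGraph V) : Set (V → ℝ) :=
  convexHull ℝ {x | ∃ i j, G.Adj i j ∧ x = Pi.single i (1 : ℝ) - Pi.single j (1 : ℝ)}

/-- The dimension of the affine hull of a (nonempty) set. -/
noncomputable def affDim {E : Type*} [AddCommGroup E] [Module ℝ E] (S : Set E) : ℕ :=
  Module.finrank ℝ (vectorSpan ℝ S)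

/-- `F` is a facet of the polytope `P`: a nonempty face (the set of maximizers on `P` of a linear
functional) whose dimension is one less than that of `P`. -/
def IsFacet {E : Type*} [AddCommGroup E] [Module ℝ E] [TopologicalSpace E] (P F : Set E) : Prop :=
  F.Nonempty ∧ IsExposed ℝ P F ∧ affDim F + 1 = affDim P

/-- `N(G)`, the number of facets of the symmetric edge polytope of `G`. -/
noncomputable def numFacets {V : Type*} [DecidableEq V] (G : SimpleGraph V) : ℕ :=
  {F : Set (V → ℝ) | IsFacet (polytope G) F}.ncard

/-- The inclusion of the vertices of the second graph into the wedge: the vertex `b` is sent to the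
vertex `a` of the first graph, every other vertex to itself. -/
def wedgeRight {V W : Type*} [DecidableEq W] (a : V) (b : W) (w : W) : V ⊕ {w : W // w ≠ b} :=
  if h : w = b then Sum.inl a else Sum.inr ⟨w, h⟩

/-- The wedge `G ∨ H` obtained by identifying the vertex `a` of `G` with the vertex `b` of `H`. -/
def wedge {V W : Type*} [DecidableEq W] (G : SimpleGraph V) (a : V) (H : SimpleGraph W) (b : W) :
    SimpleGraph (V ⊕ {w : W // w ≠ b}) :=
  G.map Sum.inl ⊔ H.map (wedgeRight a b)

/-- `C_a ∨ C_b`, where `C_m` is the cycle on `m` vertices (`C_1` being a single vertex). Cycles are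
vertex-transitive, so the choice of the identified vertices is immaterial. -/
def cycleWedge (a b : ℕ) (ha : 0 < a) (hb : 0 < b) :
    SimpleGraph (Fin a ⊕ {w : Fin b // w ≠ ⟨0, hb⟩}) :=
  wedge (SimpleGraph.cycleGraph a) ⟨0, ha⟩ (SimpleGraph.cycleGraph b) ⟨0, hb⟩

/-- `C_a ∨ C_b ∨ e`, where `e` is a single edge (attached at the common vertex of the two cycles;
the number of facets does not depend on where it is attached). -/
def cycleWedgeEdge (a b : ℕ) (ha : 0 < a) (hb : 0 < b) :
    SimpleGraph ((Fin a ⊕ {w : Fin b // w ≠ ⟨0, hb⟩}) ⊕ {w : Fin 2 // w ≠ 0}) :=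
  wedge (cycleWedge a b ha hb) (Sum.inl ⟨0, ha⟩) (⊤ : SimpleGraph (Fin 2)) 0

/-- `M(n)` for `n ≥ 3`. Here `k = ⌊(n + 1) / 2⌋`, that is, `n = 2k - 1` for odd `n` and `n = 2k` for
even `n`. -/
noncomputable def M (n : ℕ) (hn : 3 ≤ n) : ℕ :=
  let k := (n + 1) / 2
  have hk : 2 ≤ k := by omega
  if Odd n then
    if Even k then numFacets (cycleWedge (k + 1) (k - 1) (by omega) (by omega))
    else numFacets (cycleWedge k k (by omega) (by omega))
  else
    if Even k then numFacets (cycleWedgeEdge (k + 1) (k - 1) (by omega) (by omega))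
    else numFacets (cycleWedgeEdge k k (by omega) (by omega))

end SymmetricEdge

open SymmetricEdge

/-! Facets of `P_G` correspond to integer labelings of the vertices, zero at a root, that change by
at most one along each edge and whose tight edges (change exactly one) connect all vertices
(`numFacets_eq_ncard`).

Let `v` be a leaf and root at its neighbour. A labeling restricts to one of `G - v`, and its value
at `v` is `1` or `-1`, since the leaf edge has to be tight. So `N(G) ≤ 2 N(G - v)`
(`ncard_facetLabelings_le_of_leaf`). As `G - v` is connected with one vertex and one edge fewer, the
hypothesis bounds `N(G - v)` by `M n`.

It remains to see `2 M(n) ≤ M(n + 1)` (`two_mul_M_le`). Labelings multiply over wedges, and an edge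
has two. For odd `n`, `G_{n+1} = G_n ∨ e`, giving equality. For even `n`, `G_{n+1}` arises from
`G_n` by dropping `e` and lengthening an odd cycle by two vertices; since `N(C_{2j+1}) = (2j+1) *
centralBinom j` grows at least fourfold, this outweighs the lost factor two with a further factor
two to spare. -/

namespace SymmetricEdge

/-! ### Faces of a convex hull and their dimensions -/

section Faces

variable {E : Type*} [AddCommGroup E] [Module ℝ E]

/-- The pair of conditions cuts out a convex set: equality in a convex combination forces equality
in every term of nonzero weight. -/
theorem convexHull_le_one_and_mem_span {A : Set E} {l : E →ₗ[ℝ] ℝ} (hl : ∀ a ∈ A, l a ≤ 1)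
    {x : E} (hx : x ∈ convexHull ℝ A) :
    l x ≤ 1 ∧ (l x = 1 → x ∈ Submodule.span ℝ {a ∈ A | l a = 1}) := by
  set S := Submodule.span ℝ {a ∈ A | l a = 1}
  have hc : Convex ℝ {x | l x ≤ 1 ∧ (l x = 1 → x ∈ S)} := by
    intro x hx y hy a b ha hb hab
    have h1 : l (a • x + b • y) = a * l x + b * l y := by simp
    have h2 : a * l x ≤ a := by nlinarith [hx.1]
    have h3 : b * l y ≤ b := by nlinarith [hy.1]
    refine ⟨by linarith, fun h => ?_⟩
    have h4 : a * l x = a := by linarith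
    have h5 : b * l y = b := by linarith
    refine S.add_mem ?_ ?_
    · rcases eq_or_ne a 0 with h0 | h0
      · simp [h0]
      · exact S.smul_mem _ (hx.2 (mul_left_cancel₀ h0 (by linarith)))
    · rcases eq_or_ne b 0 with h0 | h0
      · simp [h0]
      · exact S.smul_mem _ (hy.2 (mul_left_cancel₀ h0 (by linarith)))
  exact convexHull_min (t := {x | l x ≤ 1 ∧ (l x = 1 → x ∈ S)})
    (fun a ha => ⟨hl a ha, fun h => Submodule.subset_span ⟨ha, h⟩⟩) hc hx

theorem span_convexHull_face {A : Set E} {l : E →ₗ[ℝ] ℝ} (hl : ∀ a ∈ A, l a ≤ 1) :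
    Submodule.span ℝ {x ∈ convexHull ℝ A | l x = 1} = Submodule.span ℝ {a ∈ A | l a = 1} := by
  apply le_antisymm
  · exact Submodule.span_le.2 fun x hx => (convexHull_le_one_and_mem_span hl hx.1).2 hx.2
  · exact Submodule.span_mono fun a ha => ⟨subset_convexHull ℝ A ha.1, ha.2⟩

theorem vectorSpan_eq_span_of_zero_mem {A : Set E} (h0 : (0 : E) ∈ A) :
    vectorSpan ℝ A = Submodule.span ℝ A := by
  simp [vectorSpan_eq_span_vsub_set_right ℝ h0]

theorem span_convexHull_eq (A : Set E) :
    Submodule.span ℝ (convexHull ℝ A) = Submodule.span ℝ A := by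
  apply le_antisymm
  · exact Submodule.span_le.2 (convexHull_min Submodule.subset_span (Submodule.convex _))
  · exact Submodule.span_mono (subset_convexHull ℝ A)

theorem zero_mem_convexHull_of_neg_mem {A : Set E} (hne : A.Nonempty) (hneg : ∀ a ∈ A, -a ∈ A) :
    (0 : E) ∈ convexHull ℝ A := by
  obtain ⟨a, ha⟩ := hne
  have := convex_convexHull ℝ A (subset_convexHull ℝ A ha) (subset_convexHull ℝ A (hneg a ha))
    (by norm_num : (0 : ℝ) ≤ 1 / 2) (by norm_num : (0 : ℝ) ≤ 1 / 2) (by norm_num)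
  simpa using this

variable [FiniteDimensional ℝ E]

/-- `F` lies in an affine hyperplane missing the origin, so its linear span is the direct sum of its
direction and the line through any of its points. -/
theorem affDim_add_one_eq_finrank_span {F : Set E} (l : E →ₗ[ℝ] ℝ) (hne : F.Nonempty)
    (hl : ∀ x ∈ F, l x = 1) : affDim F + 1 = Module.finrank ℝ (Submodule.span ℝ F) := by
  obtain ⟨x, hx⟩ := hne
  have hx0 : x ≠ 0 := by
    rintro rfl
    simpa using hl 0 hx
  have hle : vectorSpan ℝ F ≤ l.ker := by
    rw [vectorSpan_eq_span_vsub_set_right ℝ hx, Submodule.span_le]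
    rintro _ ⟨y, hy, rfl⟩
    simp [hl y hy, hl x hx]
  have hsup : Submodule.span ℝ F = vectorSpan ℝ F ⊔ Submodule.span ℝ {x} := by
    apply le_antisymm
    · refine Submodule.span_le.2 fun y hy => ?_
      have : y = (y - x) + x := by abel
      rw [this]
      exact Submodule.add_mem_sup (vsub_mem_vectorSpan ℝ hy hx) (Submodule.mem_span_singleton_self x)
    · refine sup_le ?_ (Submodule.span_mono (by simpa using hx))
      rw [vectorSpan_eq_span_vsub_set_right ℝ hx, Submodule.span_le]
      rintro _ ⟨y, hy, rfl⟩
      exact Submodule.sub_mem _ (Submodule.subset_span hy) (Submodule.subset_span hx)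
  have hinf : vectorSpan ℝ F ⊓ Submodule.span ℝ {x} = ⊥ := by
    rw [eq_bot_iff]
    rintro y ⟨hy, hyx⟩
    obtain ⟨c, rfl⟩ := Submodule.mem_span_singleton.1 hyx
    have : l (c • x) = 0 := hle hy
    have hc : c = 0 := by simpa [hl x hx] using this
    simp [hc]
  have := Submodule.finrank_sup_add_finrank_inf_eq (vectorSpan ℝ F) (Submodule.span ℝ {x})
  rw [hinf, finrank_bot, finrank_span_singleton hx0, ← hsup] at this
  simpa [affDim] using this.symm

/-- By symmetry the hull contains `0`, so its dimension is that of the span of `A`; the face is a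
facet when its own span is just as large. -/
theorem affDim_face_add_one_eq_iff {A : Set E} (hneg : ∀ a ∈ A, -a ∈ A)
    {l : E →ₗ[ℝ] ℝ} (hl : ∀ a ∈ A, l a ≤ 1) (hne : {x ∈ convexHull ℝ A | l x = 1}.Nonempty) :
    affDim {x ∈ convexHull ℝ A | l x = 1} + 1 = affDim (convexHull ℝ A) ↔
      A ⊆ Submodule.span ℝ {a ∈ A | l a = 1} := by
  have hA : A.Nonempty := convexHull_nonempty_iff.1 (hne.mono fun x hx => hx.1)
  rw [affDim_add_one_eq_finrank_span l hne fun x hx => hx.2, span_convexHull_face hl, affDim,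
    vectorSpan_eq_span_of_zero_mem (zero_mem_convexHull_of_neg_mem hA hneg), span_convexHull_eq,
    ← SetLike.coe_subset_coe.trans Submodule.span_le]
  have hle : Submodule.span ℝ {a ∈ A | l a = 1} ≤ Submodule.span ℝ A :=
    Submodule.span_mono fun a ha => ha.1
  constructor
  · intro h
    exact (Submodule.eq_of_le_of_finrank_le hle h.ge).ge
  · intro h
    rw [le_antisymm hle h]

end Faces

/-! ### Facets as rigid integral labelings -/

section Labelings

variable {V : Type*}

/-- The edges of `G` along which `f` drops by one connect all vertices: a function that is constant
along all these edges is constant. -/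
def IsRigid (G : SimpleGraph V) (f : V → ℝ) : Prop :=
  ∀ g : V → ℝ, (∀ u v, G.Adj u v → f u - f v = 1 → g u = g v) → ∀ u v, g u = g v

/-- The integral labelings `f` of the vertices, normalized by `f r = 0`, that change by at most one
along every edge and for which the edges with a change of exactly one form a connected spanning
subgraph. -/
def facetLabelings (G : SimpleGraph V) (r : V) : Set (V → ℤ) :=
  {f | f r = 0 ∧ (∀ u v, G.Adj u v → f u - f v ≤ 1) ∧ IsRigid G (fun v => (f v : ℝ))}

/-- Every function that is constant along the edges is constant. -/
def EdgeConnected (G : SimpleGraph V) : Prop :=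
  ∀ g : V → ℝ, (∀ u v, G.Adj u v → g u = g v) → ∀ u v, g u = g v

theorem edgeConnected_of_preconnected {G : SimpleGraph V} (h : G.Preconnected) :
    EdgeConnected G := by
  intro g hg u v
  obtain ⟨p⟩ := h u v
  induction p with
  | nil => rfl
  | cons h _ ih => exact (hg _ _ h).trans ih

/-- Fractional parts do not change along tight edges, so they all equal the one at `r`. -/
theorem IsRigid.exists_int {G : SimpleGraph V} {f : V → ℝ} (h : IsRigid G f) {r : V}
    (hr : f r = 0) : ∃ f' : V → ℤ, ∀ v, f v = f' v := by
  have := h (fun v => Int.fract (f v)) fun u v _ huv => by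
    have : f u = f v + 1 := by linarith
    simp [this]
  choose f' hf' using fun v => Int.fract_eq_zero_iff.1 ((this v r).trans (by simp [hr]))
  exact ⟨f', fun v => (hf' v).symm⟩

theorem IsRigid.eq_of_forall {G : SimpleGraph V} {f f' : V → ℝ} (h : IsRigid G f) {r : V}
    (hr : f r = f' r) (hff : ∀ u v, G.Adj u v → f u - f v = 1 → f' u - f' v = 1) : f = f' := by
  have := h (fun v => f v - f' v) fun u v huv h1 => by linarith [hff u v huv h1]
  funext v
  linarith [this v r]

/-- The vectors spanning the polytope. -/
def edgeVectors [DecidableEq V] (G : SimpleGraph V) : Set (V → ℝ) :=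
  {x | ∃ i j, G.Adj i j ∧ x = Pi.single i (1 : ℝ) - Pi.single j (1 : ℝ)}

theorem neg_mem_edgeVectors [DecidableEq V] {G : SimpleGraph V} : ∀ a ∈ edgeVectors G, -a ∈ edgeVectors G := by
  rintro _ ⟨i, j, h, rfl⟩
  exact ⟨j, i, h.symm, by simp⟩

variable [Fintype V]

/-- A labeling is determined by its set of tight edges. -/
theorem finite_facetLabelings (G : SimpleGraph V) (r : V) : (facetLabelings G r).Finite := by
  refine Set.Finite.of_finite_image (f := fun f => {p : V × V | f p.1 - f p.2 = 1})
    (Set.toFinite _) ?_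
  rintro f hf f' hf' h
  have := hf.2.2.eq_of_forall (f' := fun v => (f' v : ℝ)) (r := r) (by simp [hf.1, hf'.1])
    fun u v _ h1 => by
      have : (u, v) ∈ {p : V × V | f p.1 - f p.2 = 1} := by
        change f u - f v = 1
        exact_mod_cast h1
      have hT : {p : V × V | f p.1 - f p.2 = 1} = {p : V × V | f' p.1 - f' p.2 = 1} := h
      rw [hT] at this
      have h2 : f' u - f' v = 1 := this
      exact_mod_cast h2
  funext v
  exact_mod_cast congrFun this v

/-- The pairing with `f`, as a linear functional. -/
noncomputable def pairing (f : V → ℝ) : StrongDual ℝ (V → ℝ) :=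
  ∑ i, f i • ContinuousLinearMap.proj i

variable [DecidableEq V]

theorem pairing_single_sub_single (f : V → ℝ) (u v : V) :
    pairing f (Pi.single u 1 - Pi.single v 1) = f u - f v := by
  simp [pairing, mul_sub, Finset.sum_sub_distrib, Pi.single_apply]

/-- Duality: a functional vanishing on the tight edge vectors is, on basis vectors, a function
constant along tight edges. -/
theorem edgeVectors_subset_span_iff {G : SimpleGraph V} (hG : EdgeConnected G) (f : V → ℝ) :
    edgeVectors G ⊆ Submodule.span ℝ {a ∈ edgeVectors G | pairing f a = 1} ↔ IsRigid G f := by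
  constructor
  · intro h g hg
    refine hG g fun u v huv => ?_
    have hker : Submodule.span ℝ {a ∈ edgeVectors G | pairing f a = 1} ≤
        (pairing g : (V → ℝ) →ₗ[ℝ] ℝ).ker := by
      rw [Submodule.span_le]
      rintro _ ⟨⟨i, j, hij, rfl⟩, h1⟩
      rw [pairing_single_sub_single] at h1
      simpa [sub_eq_zero, pairing_single_sub_single] using hg i j hij h1
    have := hker (h ⟨u, v, huv, rfl⟩)
    rw [LinearMap.mem_ker, ContinuousLinearMap.coe_coe, pairing_single_sub_single] at this
    linarith
  · rintro h _ ⟨i, j, hij, rfl⟩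
    by_contra hn
    obtain ⟨l, hl, hker⟩ := Submodule.exists_le_ker_of_notMem hn
    apply hl
    have := h (fun u => l (Pi.single u 1)) (fun u v huv h1 => by
      have : (Pi.single u (1 : ℝ) - Pi.single v 1 : V → ℝ) ∈ l.ker :=
        hker (Submodule.subset_span ⟨⟨u, v, huv, rfl⟩, by rw [pairing_single_sub_single, h1]⟩)
      rwa [LinearMap.mem_ker, map_sub, sub_eq_zero] at this) i j
    rw [map_sub, this, sub_self]

/-- The face of the symmetric edge polytope cut out by `f`. -/
def face (G : SimpleGraph V) (f : V → ℝ) : Set (V → ℝ) :=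
  {x ∈ polytope G | pairing f x = 1}

theorem pairing_le_one {G : SimpleGraph V} {f : V → ℝ} (hf : ∀ u v, G.Adj u v → f u - f v ≤ 1) :
    ∀ a ∈ edgeVectors G, (pairing f : (V → ℝ) →ₗ[ℝ] ℝ) a ≤ 1 := by
  rintro _ ⟨i, j, hij, rfl⟩
  simpa [pairing_single_sub_single] using hf i j hij

theorem mem_face_iff {G : SimpleGraph V} {f : V → ℝ} {u v : V} (huv : G.Adj u v) :
    Pi.single u 1 - Pi.single v 1 ∈ face G f ↔ f u - f v = 1 := by
  rw [← pairing_single_sub_single f u v]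
  exact ⟨fun h => h.2, fun h => ⟨subset_convexHull ℝ _ ⟨u, v, huv, rfl⟩, h⟩⟩

theorem isFacet_face [Nontrivial V] {G : SimpleGraph V} (hG : EdgeConnected G) {f : V → ℝ}
    (hf : ∀ u v, G.Adj u v → f u - f v ≤ 1) (hr : IsRigid G f) :
    IsFacet (polytope G) (face G f) := by
  -- With no tight edge, rigidity would make every function on at least two vertices constant.
  have hne : (face G f).Nonempty := by
    by_contra hne
    obtain ⟨u, v, huv⟩ := exists_pair_ne V
    have := hr (Pi.single u 1) (fun x y hxy h1 => (hne ⟨_, (mem_face_iff hxy).2 h1⟩).elim) u v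
    simp [huv.symm] at this
  refine ⟨hne, fun _ => ⟨pairing f, ?_⟩, ?_⟩
  · obtain ⟨x0, hx0, h0⟩ := hne
    ext x
    refine and_congr_right fun hx => ⟨fun h y hy => ?_, fun h => ?_⟩
    · rw [h]
      exact (convexHull_le_one_and_mem_span (pairing_le_one hf) hy).1
    · exact le_antisymm (convexHull_le_one_and_mem_span (pairing_le_one hf) hx).1 (h0 ▸ h x0 hx0)
  · exact (affDim_face_add_one_eq_iff neg_mem_edgeVectors (pairing_le_one hf) hne).2
      ((edgeVectors_subset_span_iff hG f).2 hr)

/-- The exposing functional has maximum `c > 0`: for `c = 0` symmetry would make it vanish on the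
polytope, so `F` would be everything. Dividing by `c` and shifting by the value at `r`, which
differences do not see, gives `f`. -/
theorem IsFacet.exists_eq_face {G : SimpleGraph V} (hG : EdgeConnected G) {F : Set (V → ℝ)}
    (hF : IsFacet (polytope G) F) (r : V) :
    ∃ f : V → ℝ, f r = 0 ∧ (∀ u v, G.Adj u v → f u - f v ≤ 1) ∧ IsRigid G f ∧ F = face G f := by
  obtain ⟨hne, hexp, hdim⟩ := hF
  obtain ⟨l, hl⟩ := hexp hne
  have hx0 := hne
  obtain ⟨x0, hx0⟩ := hx0
  have hx0' := hx0
  rw [hl] at hx0'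
  have hA : (edgeVectors G).Nonempty := convexHull_nonempty_iff.1 ⟨x0, hx0'.1⟩
  set c := l x0
  have hle : ∀ u v, G.Adj u v → l (Pi.single u 1 - Pi.single v 1) ≤ c := fun u v huv =>
    hx0'.2 _ (subset_convexHull ℝ _ ⟨u, v, huv, rfl⟩)
  have hc0 : 0 ≤ c := by
    simpa using hx0'.2 0 (zero_mem_convexHull_of_neg_mem hA neg_mem_edgeVectors)
  have hc : 0 < c := by
    refine lt_of_le_of_ne hc0 fun hc => ?_
    have hz : ∀ x ∈ polytope G, l x = 0 := by
      have hs : polytope G ⊆ (l : (V → ℝ) →ₗ[ℝ] ℝ).ker := by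
        refine convexHull_min ?_ (Submodule.convex _)
        rintro _ ⟨u, v, huv, rfl⟩
        have h1 := hle u v huv
        have h2 := hle v u huv.symm
        rw [map_sub] at h1 h2
        simp only [SetLike.mem_coe, LinearMap.mem_ker, ContinuousLinearMap.coe_coe, map_sub]
        linarith
      exact fun x hx => hs hx
    have : F = polytope G := by
      rw [hl]
      ext x
      exact ⟨fun h => h.1, fun h => ⟨h, fun y hy => by rw [hz x h, hz y hy]⟩⟩
    rw [this] at hdim
    omega
  have hlp : ∀ x ∈ polytope G,
      l x = c * pairing (fun u => (l (Pi.single u 1) - l (Pi.single r 1)) / c) x := by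
    set p := pairing (fun u => (l (Pi.single u 1) - l (Pi.single r 1)) / c)
    have hs : polytope G ⊆ ((l - c • p : StrongDual ℝ (V → ℝ)) : (V → ℝ) →ₗ[ℝ] ℝ).ker := by
      refine convexHull_min ?_ (Submodule.convex _)
      rintro _ ⟨u, v, huv, rfl⟩
      simp only [SetLike.mem_coe, LinearMap.mem_ker, ContinuousLinearMap.coe_coe,
        sub_apply, smul_apply, p,
        pairing_single_sub_single, smul_eq_mul]
      rw [map_sub]
      field_simp
      ring
    intro x hx
    have : l x - c * p x = 0 := hs hx
    linarith
  set f : V → ℝ := fun u => (l (Pi.single u 1) - l (Pi.single r 1)) / c with hfdef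
  have hf : ∀ u v, G.Adj u v → f u - f v ≤ 1 := by
    intro u v huv
    have := hle u v huv
    rw [map_sub] at this
    rw [hfdef]
    simp only [← sub_div]
    rw [div_le_one hc]
    linarith
  have hFf : F = face G f := by
    rw [hl]
    ext x
    refine and_congr_right fun hx => ⟨fun h => ?_, fun h y hy => ?_⟩
    · have : l x = c := le_antisymm (hx0'.2 x hx) (h x0 hx0'.1)
      rw [hlp x hx] at this
      exact mul_left_cancel₀ hc.ne' (by linarith)
    · rw [hlp x hx, h, mul_one]
      exact hx0'.2 y hy
  refine ⟨f, by simp [hfdef], hf, ?_, hFf⟩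
  rw [hFf] at hdim hne
  exact (edgeVectors_subset_span_iff hG f).1
    ((affDim_face_add_one_eq_iff neg_mem_edgeVectors (pairing_le_one hf) hne).1 hdim)

/-- The facets of the symmetric edge polytope of a connected graph correspond to the integral
labelings with a connected spanning set of tight edges. -/
theorem numFacets_eq_ncard [Nontrivial V] {G : SimpleGraph V} (hG : EdgeConnected G) (r : V) :
    numFacets G = (facetLabelings G r).ncard := by
  have hinj : Set.InjOn (fun f : V → ℤ => face G (fun v => (f v : ℝ))) (facetLabelings G r) := by
    rintro f hf f' hf' h
    have := hf.2.2.eq_of_forall (f' := fun v => (f' v : ℝ)) (r := r) (by simp [hf.1, hf'.1])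
      fun u v huv h1 => by
        have h2 := (mem_face_iff (f := fun v => (f v : ℝ)) huv).2 h1
        have hF : face G (fun v => (f v : ℝ)) = face G (fun v => (f' v : ℝ)) := h
        rw [hF] at h2
        exact (mem_face_iff huv).1 h2
    funext v
    exact_mod_cast congrFun this v
  rw [← hinj.ncard_image, numFacets]
  congr 1
  ext F
  constructor
  · intro hF
    obtain ⟨f, h0, hf, hr, rfl⟩ := hF.exists_eq_face hG r
    obtain ⟨f', hf'⟩ := hr.exists_int h0
    obtain rfl : f = fun v => (f' v : ℝ) := funext hf'
    simp only at h0 hf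
    exact ⟨f', ⟨by exact_mod_cast h0, fun u v huv => by exact_mod_cast hf u v huv, hr⟩, rfl⟩
  · rintro ⟨f, hf, rfl⟩
    exact isFacet_face hG (fun u v huv => by exact_mod_cast hf.2.1 u v huv) hf.2.2

end Labelings

/-! ### Multiplicativity over wedges -/

section Wedge

variable {V W : Type*} [DecidableEq W] {a : V} {b : W}

@[simp]
theorem wedgeRight_self : wedgeRight a b b = Sum.inl a := by
  simp [wedgeRight]

@[simp]
theorem wedgeRight_coe (w : {w : W // w ≠ b}) : wedgeRight a b w = Sum.inr w := by
  simp [wedgeRight, w.2]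

theorem wedgeRight_injective : Function.Injective (wedgeRight a b) := by
  intro x y h
  unfold wedgeRight at h
  split_ifs at h with h1 h2
  · rw [h1, h2]
  · simpa using h

theorem forall_wedge_adj {G : SimpleGraph V} {H : SimpleGraph W}
    {Q : V ⊕ {w : W // w ≠ b} → V ⊕ {w : W // w ≠ b} → Prop} :
    (∀ x y, (wedge G a H b).Adj x y → Q x y) ↔
      (∀ u v, G.Adj u v → Q (Sum.inl u) (Sum.inl v)) ∧
        ∀ u v, H.Adj u v → Q (wedgeRight a b u) (wedgeRight a b v) := by
  constructor
  · intro h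
    refine ⟨fun u v huv => h _ _ (Or.inl ?_), fun u v huv => h _ _ (Or.inr ?_)⟩
    · exact G.map_adj_apply' huv (fun h => huv.ne (Sum.inl_injective h))
    · exact H.map_adj_apply' huv (fun h => huv.ne (wedgeRight_injective h))
  · rintro ⟨h1, h2⟩ x y (⟨-, u, v, huv, rfl, rfl⟩ | ⟨-, u, v, huv, rfl, rfl⟩)
    · exact h1 u v huv
    · exact h2 u v huv

/-- Constancy of all functions constant along a relation holds for a wedge exactly when it holds
for the two parts. -/
theorem forall_const_wedge_iff {G : SimpleGraph V} {H : SimpleGraph W}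
    {Q : V ⊕ {w : W // w ≠ b} → V ⊕ {w : W // w ≠ b} → Prop} :
    (∀ g : V ⊕ {w : W // w ≠ b} → ℝ, (∀ x y, (wedge G a H b).Adj x y → Q x y → g x = g y) →
        ∀ x y, g x = g y) ↔
      (∀ g : V → ℝ, (∀ u v, G.Adj u v → Q (Sum.inl u) (Sum.inl v) → g u = g v) →
        ∀ u v, g u = g v) ∧
      ∀ g : W → ℝ, (∀ u v, H.Adj u v → Q (wedgeRight a b u) (wedgeRight a b v) → g u = g v) →
        ∀ u v, g u = g v := by
  have hR : ∀ (g : V → ℝ) (g' : W → ℝ), g a = g' b → ∀ w,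
      Sum.elim g (fun w : {w : W // w ≠ b} => g' w) (wedgeRight a b w) = g' w := by
    intro g g' h w
    by_cases hw : w = b
    · simp [hw, h]
    · simp [wedgeRight, hw]
  constructor
  · intro h
    refine ⟨fun g hg u v => ?_, fun g hg u v => ?_⟩
    -- A test function on one part is extended to the other by its value at the common vertex.
    · refine h (Sum.elim g fun w => (fun _ => g a) w.1)
        (forall_wedge_adj.2 ⟨fun u v => hg u v, fun u v _ _ => ?_⟩) (Sum.inl u) (Sum.inl v)
      rw [hR g (fun _ => g a) rfl, hR g (fun _ => g a) rfl]
    · have := h (Sum.elim (fun _ => g b) fun w => g w)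
        (forall_wedge_adj.2 ⟨fun u v _ _ => rfl, fun u v huv hQ => ?_⟩)
        (wedgeRight a b u) (wedgeRight a b v)
      · rwa [hR _ g rfl, hR _ g rfl] at this
      · rw [hR _ g rfl, hR _ g rfl]
        exact hg u v huv hQ
  · rintro ⟨h1, h2⟩ g hg
    rw [forall_wedge_adj] at hg
    have h3 := h1 (fun v => g (Sum.inl v)) hg.1
    have h4 := h2 (fun w => g (wedgeRight a b w)) hg.2
    have h5 : ∀ x, g x = g (Sum.inl a) := by
      rintro (v | w)
      · exact h3 v a
      · simpa using h4 w b
    exact fun x y => (h5 x).trans (h5 y).symm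

theorem EdgeConnected.wedge {G : SimpleGraph V} {H : SimpleGraph W} (hG : EdgeConnected G)
    (hH : EdgeConnected H) : EdgeConnected (wedge G a H b) := by
  have := (forall_const_wedge_iff (a := a) (b := b) (G := G) (H := H) (Q := fun _ _ => True)).2
    ⟨fun g hg => hG g (by simpa using hg), fun g hg => hH g (by simpa using hg)⟩
  exact fun g hg => this g (by simpa using hg)

theorem mem_facetLabelings_wedge_iff {G : SimpleGraph V} {H : SimpleGraph W}
    {f : V ⊕ {w : W // w ≠ b} → ℤ} :
    f ∈ facetLabelings (wedge G a H b) (Sum.inl a) ↔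
      (fun v => f (Sum.inl v)) ∈ facetLabelings G a ∧
        (fun w => f (wedgeRight a b w)) ∈ facetLabelings H b := by
  have h1 := forall_wedge_adj (a := a) (b := b) (G := G) (H := H) (Q := fun x y => f x - f y ≤ 1)
  have h2 := forall_const_wedge_iff (a := a) (b := b) (G := G) (H := H)
    (Q := fun x y => (f x : ℝ) - f y = 1)
  simp only [facetLabelings, Set.mem_ofPred_eq, IsRigid, wedgeRight_self]
  rw [h1, h2]
  tauto

/-- Rooted at the common vertex, labelings of both parts vanish there and so glue uniquely. -/
theorem ncard_facetLabelings_wedge (G : SimpleGraph V) (H : SimpleGraph W) (a : V) (b : W) :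
    (facetLabelings (wedge G a H b) (Sum.inl a)).ncard =
      (facetLabelings G a).ncard * (facetLabelings H b).ncard := by
  rw [← Set.ncard_prod]
  refine Set.ncard_congr (fun f _ => (fun v => f (Sum.inl v), fun w => f (wedgeRight a b w)))
    (fun f hf => mem_facetLabelings_wedge_iff.1 hf) ?_ ?_
  · intro f f' _ _ h
    rw [Prod.mk.injEq] at h
    funext x
    rcases x with v | w
    · exact congrFun h.1 v
    · simpa using congrFun h.2 w.1
  · rintro ⟨f, f'⟩ ⟨hf, hf'⟩
    have hR : ∀ w, Sum.elim f (fun w : {w : W // w ≠ b} => f' w) (wedgeRight a b w) = f' w := by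
      intro w
      by_cases hw : w = b
      · simpa [hw] using (show f a = 0 from hf.1).trans (show f' b = 0 from hf'.1).symm
      · simp [wedgeRight, hw]
    refine ⟨Sum.elim f fun w => f' w, mem_facetLabelings_wedge_iff.2 ?_, ?_⟩
    · simp only [hR, Sum.elim_inl]
      exact ⟨hf, hf'⟩
    · simp only [hR, Sum.elim_inl]

end Wedge

/-! ### Single edges and leaves -/

theorem ncard_facetLabelings_edge : (facetLabelings (⊤ : SimpleGraph (Fin 2)) 0).ncard = 2 := by
  have : facetLabelings (⊤ : SimpleGraph (Fin 2)) 0 = {![0, 1], ![0, -1]} := by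
    ext f
    simp only [facetLabelings, Set.mem_ofPred_eq, Set.mem_insert_iff, Set.mem_singleton_iff]
    constructor
    · rintro ⟨h0, h1, h2⟩
      have h3 := h1 0 1 (by simp)
      have h4 := h1 1 0 (by simp)
      have h5 : f 1 ≠ 0 := by
        intro h
        have := h2 ![0, 1] (by
          intro u v _ huv
          fin_cases u <;> fin_cases v <;> simp [h0, h] at huv ⊢) 0 1
        simp at this
      have : f 1 = 1 ∨ f 1 = -1 := by omega
      rcases this with h | h
      · left
        funext i
        fin_cases i <;> simp [h0, h]
      · right
        funext i
        fin_cases i <;> simp [h0, h]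
    · have key : ∀ f : Fin 2 → ℤ, f 0 = 0 → (f 1 = 1 ∨ f 1 = -1) →
          f 0 = 0 ∧ (∀ u v, (⊤ : SimpleGraph (Fin 2)).Adj u v → f u - f v ≤ 1) ∧
            IsRigid ⊤ (fun v => (f v : ℝ)) := by
        intro f h0 h1
        refine ⟨h0, fun u v _ => ?_, fun g hg => ?_⟩
        · rcases h1 with h1 | h1 <;> fin_cases u <;> fin_cases v <;> simp [h0, h1]
        · have : g 0 = g 1 := by
            rcases h1 with h1 | h1
            · exact (hg 1 0 (by simp) (by simp [h0, h1])).symm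
            · exact hg 0 1 (by simp) (by simp [h0, h1])
          intro u v
          fin_cases u <;> fin_cases v <;> simp [this]
      rintro (rfl | rfl) <;> exact key _ (by simp) (by simp)
  rw [this]
  refine Set.ncard_pair fun h => ?_
  simpa using congrFun h 1

theorem ncard_facetLabelings_le_of_leaf {n : ℕ} {G : SimpleGraph (Fin (n + 1))}
    {v : Fin (n + 1)} {w : Fin n} (h : ∀ u, G.Adj v u ↔ u = v.succAbove w) :
    (facetLabelings G (v.succAbove w)).ncard ≤
      2 * (facetLabelings (G.comap v.succAbove) w).ncard := by
  have h2 : ({1, -1} : Set ℤ).ncard = 2 := Set.ncard_pair (by norm_num)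
  rw [mul_comm, ← h2, ← Set.ncard_prod]
  refine Set.ncard_le_ncard_of_injOn (fun f => (fun u => f (v.succAbove u), f v)) ?_ ?_
    ((finite_facetLabelings _ _).prod (Set.toFinite _))
  · rintro f ⟨h0, h1, hr⟩
    refine ⟨⟨h0, fun u u' huu => h1 _ _ huu, fun g hg u u' => ?_⟩, ?_⟩
    -- The test function takes at the leaf its value at the neighbour, so the leaf edge imposes
    -- nothing.
    · have := hr (Fin.insertNth v (g w) g) (fun x y hxy hf => ?_)
        (v.succAbove u) (v.succAbove u')
      · simpa using this
      rcases Fin.eq_self_or_eq_succAbove v x with rfl | ⟨x, rfl⟩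
      · obtain rfl := (h y).1 hxy
        simp
      · rcases Fin.eq_self_or_eq_succAbove v y with rfl | ⟨y, rfl⟩
        · have := Fin.succAbove_right_injective ((h _).1 hxy.symm)
          simp [this]
        · simpa using hg x y hxy hf
    · have hadj := (h _).2 rfl
      have h3 := h1 _ _ hadj
      have h4 := h1 _ _ hadj.symm
      have h5 : f v ≠ 0 := by
        intro hv
        -- If the leaf edge is not tight, the indicator of the leaf contradicts rigidity.
        have := hr (Pi.single v 1) (fun x y hxy hf => ?_) v (v.succAbove w)
        · simp [Fin.succAbove_ne] at this
        · by_cases hx : x = v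
          · subst hx
            obtain rfl := (h y).1 hxy
            simp [hv, h0] at hf
          · by_cases hy : y = v
            · subst hy
              obtain rfl := (h x).1 hxy.symm
              simp [hv, h0] at hf
            · simp [hx, hy]
      have : f v = 1 ∨ f v = -1 := by omega
      simpa using this
  · intro f _ f' _ hff
    rw [Prod.mk.injEq] at hff
    funext x
    rcases Fin.eq_self_or_eq_succAbove v x with rfl | ⟨x, rfl⟩
    · exact hff.2
    · exact congrFun hff.1 x

/-! ### Counting the labelings of odd cycles -/

section Cycle

variable {n : ℕ}

/-- A cycle without one edge is still a connected path, traversed here from `i + 1`. -/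
theorem forall_eq_of_forall_add_one_eq {α : Type*} {g : Fin (n + 1) → α} {i : Fin (n + 1)}
    (h : ∀ x, x ≠ i → g (x + 1) = g x) : ∀ x y, g x = g y := by
  have key : ∀ y, g (i + 1 + y) = g (i + 1) := by
    intro y
    induction y using Fin.induction with
    | zero => simp
    | succ y ih =>
      rw [← Fin.coeSucc_eq_succ, ← add_assoc, h, ih]
      intro hy
      have h0 : y.castSucc + 1 = 0 := by
        have : i + (y.castSucc + 1) = i := by
          rw [← add_assoc, add_right_comm, hy]
        exact add_eq_left.1 this
      rw [Fin.coeSucc_eq_succ] at h0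
      exact Fin.succ_ne_zero _ h0
  have key' : ∀ x, g x = g (i + 1) := fun x => by
    have := key (x - (i + 1))
    rwa [add_sub_cancel] at this
  exact fun x y => (key' x).trans (key' y).symm

theorem forall_cycleGraph_adj {Q : Fin (n + 2) → Fin (n + 2) → Prop} :
    (∀ u v, (SimpleGraph.cycleGraph (n + 2)).Adj u v → Q u v) ↔
      ∀ x, Q (x + 1) x ∧ Q x (x + 1) := by
  simp only [SimpleGraph.cycleGraph_adj, sub_eq_iff_eq_add]
  constructor
  · exact fun h x => ⟨h _ _ (Or.inl (add_comm _ _)), h _ _ (Or.inr (add_comm _ _))⟩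
  · rintro h u v (rfl | rfl)
    · rw [add_comm]
      exact (h v).1
    · rw [add_comm]
      exact (h u).2

theorem isRigid_cycleGraph_iff {f : Fin (n + 2) → ℤ}
    (hf : ∀ x, f (x + 1) - f x ≤ 1 ∧ f x - f (x + 1) ≤ 1) :
    IsRigid (SimpleGraph.cycleGraph (n + 2)) (fun v => (f v : ℝ)) ↔
      ∀ i i', f (i + 1) = f i → f (i' + 1) = f i' → i = i' := by
  have htight : ∀ g : Fin (n + 2) → ℝ,
      (∀ u v, (SimpleGraph.cycleGraph (n + 2)).Adj u v → (f u : ℝ) - f v = 1 → g u = g v) ↔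
        ∀ x, f (x + 1) ≠ f x → g (x + 1) = g x := by
    intro g
    rw [forall_cycleGraph_adj (Q := fun u v => (f u : ℝ) - f v = 1 → g u = g v)]
    refine forall_congr' fun x => ?_
    have h1 : (f (x + 1) : ℝ) - f x = 1 ↔ f (x + 1) - f x = 1 := by norm_cast
    have h2 : (f x : ℝ) - f (x + 1) = 1 ↔ f x - f (x + 1) = 1 := by norm_cast
    rw [h1, h2]
    have := hf x
    constructor
    · rintro ⟨h3, h4⟩ hne
      have : f (x + 1) - f x = 1 ∨ f x - f (x + 1) = 1 := by omega
      rcases this with h | h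
      · exact h3 h
      · exact (h4 h).symm
    · exact fun h => ⟨fun h' => h (by omega), fun h' => (h (by omega)).symm⟩
  simp only [IsRigid, htight]
  constructor
  · intro h
    have key : ∀ i i', i < i' → f (i + 1) = f i → f (i' + 1) = f i' → False := by
      intro i i' hlt hi hi'
      -- Two flat steps cut the cycle into two arcs; the indicator of one arc contradicts rigidity.
      have := h (fun x => if i < x ∧ x ≤ i' then 1 else 0) (fun x hx => ?_) (i + 1) i
      · have hi0 : i ≠ Fin.last _ := (hlt.trans_le (Fin.le_last _)).ne
        have h1 : i < i + 1 ∧ i + 1 ≤ i' := by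
          rw [Fin.lt_def] at hlt
          rw [Fin.lt_def, Fin.le_def, Fin.val_add_one, if_neg hi0]
          omega
        simp [h1] at this
      · have h1 : x ≠ i := by rintro rfl; exact hx hi
        have h2 : x ≠ i' := by rintro rfl; exact hx hi'
        have h3 : (i < x + 1 ∧ x + 1 ≤ i') ↔ (i < x ∧ x ≤ i') := by
          have h4 := i'.2
          rw [Fin.lt_def, Fin.le_def, Fin.lt_def, Fin.le_def, Fin.val_add_one]
          rw [ne_eq, Fin.ext_iff] at h1 h2
          split_ifs with h5
          · rw [h5] at h2 ⊢
            simp only [Fin.val_last] at h2 ⊢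
            omega
          · omega
        simp only [h3]
    intro i i' hi hi'
    by_contra hne
    rcases lt_or_gt_of_ne hne with hlt | hlt
    · exact key i i' hlt hi hi'
    · exact key i' i hlt hi' hi
  · intro h g hg
    by_cases hz : ∃ i, f (i + 1) = f i
    · obtain ⟨i, hi⟩ := hz
      exact forall_eq_of_forall_add_one_eq (i := i) fun x hx => hg x fun hx' => hx (h x i hx' hi)
    · push Not at hz
      exact forall_eq_of_forall_add_one_eq (i := 0) fun x _ => hg x (hz x)

theorem sum_add_one_sub (f : Fin (n + 1) → ℤ) : ∑ x, (f (x + 1) - f x) = 0 := by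
  rw [Finset.sum_sub_distrib, sub_eq_zero]
  exact Equiv.sum_comp (Equiv.addRight 1) f

/-- The function that stays constant at the step `i`, increases by one at the steps in `A` and
decreases by one at the others. -/
def cycleStep (i : Fin (n + 2)) (A : Finset (Fin (n + 2))) (x : Fin (n + 2)) : ℤ :=
  2 * (if x ∈ A then 1 else 0) + (if x = i then 1 else 0) - 1

/-- The partial sums of `cycleStep i A`. -/
def cycleLabeling (i : Fin (n + 2)) (A : Finset (Fin (n + 2))) (x : Fin (n + 2)) : ℤ :=
  ∑ y ∈ Finset.range x, cycleStep i A (Fin.ofNat (n + 2) y)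

theorem sum_cycleStep (i : Fin (n + 2)) (A : Finset (Fin (n + 2))) :
    ∑ x, cycleStep i A x = 2 * A.card + 1 - (n + 2) := by
  simp [cycleStep, Finset.sum_add_distrib, mul_comm]

theorem cycleLabeling_zero (i : Fin (n + 2)) (A : Finset (Fin (n + 2))) :
    cycleLabeling i A 0 = 0 := by
  simp [cycleLabeling]

theorem cycleLabeling_add_one_sub {i : Fin (n + 2)} {A : Finset (Fin (n + 2))}
    (h : 2 * A.card + 1 = n + 2) (x : Fin (n + 2)) :
    cycleLabeling i A (x + 1) - cycleLabeling i A x = cycleStep i A x := by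
  have hs : cycleStep i A x = cycleStep i A (Fin.ofNat (n + 2) x) := by
    congr 1
    simp
  rw [sub_eq_iff_eq_add', hs]
  unfold cycleLabeling
  rw [← Finset.sum_range_succ (fun y => cycleStep i A (Fin.ofNat (n + 2) y)), Fin.val_add_one]
  -- Only the step from the last vertex back to `0` uses the cardinality of `A`, which makes all
  -- steps sum to zero.
  split_ifs with hx
  · subst hx
    have : ∑ y ∈ Finset.range (n + 1 + 1), cycleStep i A (Fin.ofNat (n + 2) y) =
        ∑ y, cycleStep i A y := by
      rw [Finset.sum_range]
      exact Finset.sum_congr rfl fun y _ => by congr 1; simp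
    rw [Fin.val_last, this, sum_cycleStep]
    simp
    omega
  · rfl

theorem cycleStep_eq_zero_iff {i : Fin (n + 2)} {A : Finset (Fin (n + 2))} (hi : i ∉ A)
    {x : Fin (n + 2)} : cycleStep i A x = 0 ↔ x = i := by
  unfold cycleStep
  by_cases hx : x = i
  · subst hx
    simp [hi]
  · simp only [hx, if_false, iff_false]
    split_ifs <;> omega

theorem cycleStep_eq_one_iff {i : Fin (n + 2)} {A : Finset (Fin (n + 2))} (hi : i ∉ A)
    {x : Fin (n + 2)} : cycleStep i A x = 1 ↔ x ∈ A := by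
  unfold cycleStep
  by_cases hx : x = i
  · subst hx
    simp [hi]
  · simp only [hx, if_false]
    split_ifs with h <;> simp [h]

theorem abs_cycleStep_le {i : Fin (n + 2)} {A : Finset (Fin (n + 2))} (hi : i ∉ A)
    (x : Fin (n + 2)) : cycleStep i A x ≤ 1 ∧ -1 ≤ cycleStep i A x := by
  unfold cycleStep
  by_cases hx : x = i
  · subst hx
    simp [hi]
  · simp only [hx, if_false]
    split_ifs <;> omega

theorem mem_facetLabelings_cycleGraph_iff {f : Fin (n + 2) → ℤ} :
    f ∈ facetLabelings (SimpleGraph.cycleGraph (n + 2)) 0 ↔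
      f 0 = 0 ∧ (∀ x, f (x + 1) - f x ≤ 1 ∧ f x - f (x + 1) ≤ 1) ∧
        ∀ i i', f (i + 1) = f i → f (i' + 1) = f i' → i = i' := by
  refine and_congr_right fun _ => ?_
  rw [forall_cycleGraph_adj (Q := fun u v => f u - f v ≤ 1)]
  exact and_congr_right fun h => isRigid_cycleGraph_iff h

/-- The steps around the cycle sum to zero and their number is odd, so they cannot all be `±1`.
Rigidity allows only one flat step, leaving `j` ascents and `j` descents. -/
theorem facetLabelings_cycleGraph_eq_image {j : ℕ} (hj : n + 2 = 2 * j + 1) :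
    facetLabelings (SimpleGraph.cycleGraph (n + 2)) 0 =
      (fun p : Σ _ : Fin (n + 2), Finset (Fin (n + 2)) => cycleLabeling p.1 p.2) ''
        (Finset.univ.sigma fun i => (Finset.univ.erase i).powersetCard j :
          Finset (Σ _ : Fin (n + 2), Finset (Fin (n + 2)))) := by
  ext f
  rw [mem_facetLabelings_cycleGraph_iff]
  constructor
  · rintro ⟨h0, h1, h2⟩
    set A : Finset (Fin (n + 2)) := Finset.univ.filter fun x => f (x + 1) - f x = 1 with hA
    have hsum := sum_add_one_sub f
    have hz : ∃ i, f (i + 1) = f i := by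
      by_contra! hz
      have : ∀ x, f (x + 1) - f x = 2 * (if x ∈ A then 1 else 0) - 1 := by
        intro x
        have h3 := h1 x
        have h4 := hz x
        simp only [hA, Finset.mem_filter, Finset.mem_univ, true_and]
        split_ifs <;> omega
      rw [Finset.sum_congr rfl fun x _ => this x] at hsum
      simp [Finset.sum_sub_distrib] at hsum
      omega
    obtain ⟨i, hi⟩ := hz
    have hiA : i ∉ A := by simp [hA, hi]
    have hstep : ∀ x, f (x + 1) - f x = cycleStep i A x := by
      intro x
      have h3 := h1 x
      by_cases hx : x = i
      · rw [(cycleStep_eq_zero_iff hiA).2 hx, hx, hi, sub_self]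
      · have h4 : f (x + 1) ≠ f x := fun h => hx (h2 _ _ h hi)
        simp only [cycleStep, hx, hA, Finset.mem_filter, Finset.mem_univ, true_and, if_false]
        split_ifs <;> omega
    rw [Finset.sum_congr rfl fun x _ => hstep x, sum_cycleStep] at hsum
    refine ⟨⟨i, A⟩, ?_, ?_⟩
    · simp only [Finset.coe_sigma, Set.mem_sigma_iff, Finset.mem_coe, Finset.mem_univ,
        Finset.mem_powersetCard, true_and]
      exact ⟨fun x hx => Finset.mem_erase.2 ⟨fun h => hiA (h ▸ hx), Finset.mem_univ x⟩, by omega⟩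
    · have := forall_eq_of_forall_add_one_eq (g := fun x => cycleLabeling i A x - f x) (i := 0)
        fun x _ => by
          have h3 := hstep x
          rw [← cycleLabeling_add_one_sub (i := i) (A := A) (by omega)] at h3
          linarith
      funext x
      have h3 := this x 0
      simp only [cycleLabeling_zero, h0] at h3
      linarith
  · rintro ⟨⟨i, A⟩, hp, rfl⟩
    simp only [Finset.coe_sigma, Set.mem_sigma_iff, Finset.mem_coe, Finset.mem_univ,
      Finset.mem_powersetCard, true_and] at hp
    have hiA : i ∉ A := fun h => (Finset.mem_erase.1 (hp.1 h)).1 rfl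
    have hstep := cycleLabeling_add_one_sub (i := i) (A := A) (by omega)
    have hzero : ∀ x, cycleLabeling i A (x + 1) = cycleLabeling i A x ↔ x = i := fun x => by
      rw [← sub_eq_zero, hstep, cycleStep_eq_zero_iff hiA]
    refine ⟨cycleLabeling_zero i A, fun x => ?_, fun x x' hx hx' => ?_⟩
    · have h1 := hstep x
      have h2 := abs_cycleStep_le hiA x
      constructor <;> simp only <;> omega
    · exact ((hzero x).1 hx).trans ((hzero x').1 hx').symm

theorem ncard_facetLabelings_cycleGraph_add_two {j : ℕ} (hj : n + 2 = 2 * j + 1) :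
    (facetLabelings (SimpleGraph.cycleGraph (n + 2)) 0).ncard = (2 * j + 1) * j.centralBinom := by
  rw [facetLabelings_cycleGraph_eq_image hj, Set.InjOn.ncard_image, Set.ncard_coe_finset,
    Finset.card_sigma]
  · simp [Finset.card_powersetCard, Finset.card_erase_of_mem, Nat.centralBinom, ← hj,
      show n + 1 = 2 * j by omega]
  · rintro ⟨i, A⟩ hp ⟨i', A'⟩ hp' h
    simp only [Finset.coe_sigma, Set.mem_sigma_iff, Finset.mem_coe, Finset.mem_univ,
      Finset.mem_powersetCard, true_and] at hp hp'
    have hiA : i ∉ A := fun h => (Finset.mem_erase.1 (hp.1 h)).1 rfl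
    have hiA' : i' ∉ A' := fun h => (Finset.mem_erase.1 (hp'.1 h)).1 rfl
    have hstep : ∀ x, cycleStep i A x = cycleStep i' A' x := fun x => by
      rw [← cycleLabeling_add_one_sub (by omega), ← cycleLabeling_add_one_sub (by omega)]
      exact congrArg₂ (· - ·) (congrFun h (x + 1)) (congrFun h x)
    have hii : i = i' := by
      rw [← cycleStep_eq_zero_iff hiA', ← hstep, cycleStep_eq_zero_iff hiA]
    have hAA : A = A' := by
      ext x
      rw [← cycleStep_eq_one_iff hiA, hstep, cycleStep_eq_one_iff hiA']
    rw [hii, hAA]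

theorem ncard_facetLabelings_cycleGraph {m j : ℕ} (hm : 0 < m) (hj : m = 2 * j + 1) :
    (facetLabelings (SimpleGraph.cycleGraph m) ⟨0, hm⟩).ncard = (2 * j + 1) * j.centralBinom := by
  match m, hm, hj with
  -- This case is needed for `C_3 ∨ C_1`, which occurs in `M 3` and `M 4`.
  | 1, hm, hj =>
    obtain rfl : j = 0 := by omega
    have : facetLabelings (SimpleGraph.cycleGraph 1) ⟨0, hm⟩ = {0} := by
      ext f
      simp only [Set.mem_singleton_iff]
      constructor
      · intro h
        funext x
        rw [Subsingleton.elim x ⟨0, hm⟩]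
        exact h.1
      · rintro rfl
        exact ⟨rfl, fun u v _ => by simp, fun g _ u v => by rw [Subsingleton.elim u v]⟩
    rw [this, Set.ncard_singleton]
    simp
  | n + 2, hm, hj => exact ncard_facetLabelings_cycleGraph_add_two hj

theorem edgeConnected_cycleGraph (m : ℕ) : EdgeConnected (SimpleGraph.cycleGraph m) :=
  edgeConnected_of_preconnected SimpleGraph.cycleGraph_preconnected

end Cycle

/-! ### Growth of `M` -/

section Extremal

theorem edgeConnected_cycleWedge {a b : ℕ} (ha : 0 < a) (hb : 0 < b) :
    EdgeConnected (cycleWedge a b ha hb) :=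
  (edgeConnected_cycleGraph a).wedge (edgeConnected_cycleGraph b)

theorem edgeConnected_cycleWedgeEdge {a b : ℕ} (ha : 0 < a) (hb : 0 < b) :
    EdgeConnected (cycleWedgeEdge a b ha hb) :=
  (edgeConnected_cycleWedge ha hb).wedge
    (edgeConnected_of_preconnected SimpleGraph.preconnected_top)

theorem numFacets_cycleWedge {a b i j : ℕ} (ha : 0 < a) (hb : 0 < b) (hi : a = 2 * i + 1)
    (hj : b = 2 * j + 1) (hi0 : 0 < i) :
    numFacets (cycleWedge a b ha hb) =
      ((2 * i + 1) * i.centralBinom) * ((2 * j + 1) * j.centralBinom) := by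
  have : Nontrivial (Fin a) := Fin.nontrivial_iff_two_le.2 (by omega)
  have : Nontrivial (Fin a ⊕ {w : Fin b // w ≠ ⟨0, hb⟩}) := Sum.inl_injective.nontrivial
  rw [numFacets_eq_ncard (edgeConnected_cycleWedge ha hb) (Sum.inl ⟨0, ha⟩), cycleWedge,
    ncard_facetLabelings_wedge, ncard_facetLabelings_cycleGraph ha hi,
    ncard_facetLabelings_cycleGraph hb hj]

theorem numFacets_cycleWedgeEdge {a b : ℕ} (ha : 0 < a) (hb : 0 < b) (h2 : 2 ≤ a) :
    numFacets (cycleWedgeEdge a b ha hb) = 2 * numFacets (cycleWedge a b ha hb) := by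
  have : Nontrivial (Fin a) := Fin.nontrivial_iff_two_le.2 h2
  have : Nontrivial (Fin a ⊕ {w : Fin b // w ≠ ⟨0, hb⟩}) := Sum.inl_injective.nontrivial
  have : Nontrivial ((Fin a ⊕ {w : Fin b // w ≠ ⟨0, hb⟩}) ⊕ {w : Fin 2 // w ≠ 0}) :=
    Sum.inl_injective.nontrivial
  rw [numFacets_eq_ncard (edgeConnected_cycleWedge ha hb) (Sum.inl ⟨0, ha⟩),
    numFacets_eq_ncard (edgeConnected_cycleWedgeEdge ha hb) (Sum.inl (Sum.inl ⟨0, ha⟩)),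
    cycleWedgeEdge, ncard_facetLabelings_wedge, ncard_facetLabelings_edge, mul_comm]

theorem numFacets_cycleWedge_congr {a b a' b' : ℕ} (ha : 0 < a) (hb : 0 < b) (haa : a = a')
    (hbb : b = b') : numFacets (cycleWedge a b ha hb) =
      numFacets (cycleWedge a' b' (haa ▸ ha) (hbb ▸ hb)) := by
  subst haa hbb
  rfl

/-- The exact ratio is `2(2i+3)/(i+1) = 4 + 2/(i+1)`. -/
theorem four_mul_odd_mul_centralBinom_le (i : ℕ) : 4 * ((2 * i + 1) * i.centralBinom) ≤
    (2 * (i + 1) + 1) * (i + 1).centralBinom := by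
  have h := Nat.succ_mul_centralBinom_succ i
  refine Nat.le_of_mul_le_mul_left (c := i + 1) ?_ (Nat.succ_pos i)
  calc (i + 1) * (4 * ((2 * i + 1) * i.centralBinom))
      = (2 * i + 2) * (2 * (2 * i + 1) * i.centralBinom) := by ring
    _ ≤ (2 * (i + 1) + 1) * (2 * (2 * i + 1) * i.centralBinom) :=
        Nat.mul_le_mul_right _ (by omega)
    _ = (i + 1) * ((2 * (i + 1) + 1) * (i + 1).centralBinom) := by
        rw [← h]
        ring

theorem two_mul_M_le (n : ℕ) (hn : 3 ≤ n) : 2 * M n hn ≤ M (n + 1) (Nat.le_succ_of_le hn) := by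
  rcases Nat.even_or_odd' n with ⟨k, rfl | rfl⟩
  · have h1 : (2 * k + 1) / 2 = k := by omega
    have h2 : (2 * k + 1 + 1) / 2 = k + 1 := by omega
    have ho : ¬Odd (2 * k) := by simp
    have ho' : Odd (2 * k + 1) := by simp
    unfold M
    simp only [h1, h2, ho, ho', if_true, if_false]
    -- The shorter cycle `C_{k-1}` becomes `C_{k+1}` for even `k`; one copy of `C_k` becomes
    -- `C_{k+2}` for odd `k`.
    rcases Nat.even_or_odd' k with ⟨t, rfl | rfl⟩
    · have he : Even (2 * t) := by simp
      have he' : ¬Even (2 * t + 1) := by simp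
      simp only [he, he', if_true, if_false]
      obtain ⟨s, rfl⟩ : ∃ s, t = s + 1 := ⟨t - 1, by omega⟩
      rw [numFacets_cycleWedgeEdge _ _ (by omega),
        numFacets_cycleWedge (i := s + 1) (j := s) _ _ (by omega) (by omega) (by omega),
        numFacets_cycleWedge (i := s + 1) (j := s + 1) _ _ (by omega) (by omega) (by omega)]
      have := Nat.mul_le_mul_left ((2 * (s + 1) + 1) * (s + 1).centralBinom)
        (four_mul_odd_mul_centralBinom_le s)
      linarith
    · have he : ¬Even (2 * t + 1) := by simp
      have he' : Even (2 * t + 1 + 1) := by simp [Nat.even_add_one]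
      simp only [he, he', if_true, if_false]
      rw [numFacets_cycleWedgeEdge _ _ (by omega),
        numFacets_cycleWedge (i := t) (j := t) _ _ (by omega) (by omega) (by omega),
        numFacets_cycleWedge (i := t + 1) (j := t) _ _ (by omega) (by omega) (by omega)]
      have := Nat.mul_le_mul_left ((2 * t + 1) * t.centralBinom) (four_mul_odd_mul_centralBinom_le t)
      linarith
  · have h1 : (2 * k + 1 + 1) / 2 = k + 1 := by omega
    have h2 : (2 * k + 1 + 1 + 1) / 2 = k + 1 := by omega
    have ho : Odd (2 * k + 1) := by simp
    have ho' : ¬Odd (2 * k + 1 + 1) := by simp [Nat.even_add_one]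
    unfold M
    simp only [h1, h2, ho, ho', if_true, if_false]
    split_ifs <;> rw [numFacets_cycleWedgeEdge _ _ (by omega)] <;>
      exact (congrArg (2 * ·) (numFacets_cycleWedge_congr _ _ (by omega) (by omega))).le

end Extremal

/-! ### Deleting a leaf keeps the graph in the class -/

section RemoveLeaf

variable {n : ℕ} {G : SimpleGraph (Fin (n + 1))} {v : Fin (n + 1)}

theorem connected_comap_succAbove [DecidableRel G.Adj] (hG : G.Connected) (hv : G.degree v = 1) :
    (G.comap v.succAbove).Connected := by
  have h := hG.induce_compl_singleton_of_degree_eq_one hv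
  let e : Fin n ≃ ({v}ᶜ : Set (Fin (n + 1))) := finSuccAboveEquiv v
  let iso : G.comap v.succAbove ≃g G.induce {v}ᶜ := ⟨e, Iff.rfl⟩
  exact iso.connected_iff.2 h

theorem card_edgeFinset_comap_succAbove [DecidableRel G.Adj] (hv : G.degree v = 1) :
    (G.comap v.succAbove).edgeFinset.card + 1 = G.edgeFinset.card := by
  let e : Fin n ≃ ({v}ᶜ : Set (Fin (n + 1))) := finSuccAboveEquiv v
  let iso : G.comap v.succAbove ≃g G.induce {v}ᶜ := ⟨e, Iff.rfl⟩
  rw [iso.card_edgeFinset_eq, G.card_edgeFinset_induce_compl_singleton v,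
    G.card_edgeFinset_deleteIncidenceSet v, hv]
  have : G.degree v ≤ G.edgeFinset.card := by
    rw [← G.card_incidenceFinset_eq_degree]
    exact Finset.card_le_card (G.incidenceFinset_subset v)
  omega

end RemoveLeaf


end SymmetricEdge

theorem mainTheorem9 (n : ℕ) (hn : 3 ≤ n)
    (h : ∀ (G : SimpleGraph (Fin n)) [DecidableRel G.Adj], G.Connected →
      G.edgeFinset.card = n + 1 → SymmetricEdge.numFacets G ≤ SymmetricEdge.M n hn)
    (G : SimpleGraph (Fin (n + 1))) [DecidableRel G.Adj] (hconn : G.Connected)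
    (hcard : G.edgeFinset.card = (n + 1) + 1) (hleaf : ∃ v, G.degree v = 1) :
    SymmetricEdge.numFacets G ≤ SymmetricEdge.M (n + 1) (Nat.le_succ_of_le hn) := by
  obtain ⟨v, hv⟩ := hleaf
  have hc := connected_comap_succAbove hconn hv
  have hle := h (G.comap v.succAbove) hc (by
    have := card_edgeFinset_comap_succAbove hv
    omega)
  obtain ⟨w', hw', huniq⟩ := G.degree_eq_one_iff_existsUnique_adj.1 hv
  obtain ⟨w, rfl⟩ := Fin.exists_succAbove_eq hw'.ne'
  have : Nontrivial (Fin n) := Fin.nontrivial_iff_two_le.2 (by omega)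
  have : Nontrivial (Fin (n + 1)) := Fin.nontrivial_iff_two_le.2 (by omega)
  rw [numFacets_eq_ncard (edgeConnected_of_preconnected hc.preconnected) w] at hle
  rw [numFacets_eq_ncard (edgeConnected_of_preconnected hconn.preconnected) (v.succAbove w)]
  exact (ncard_facetLabelings_le_of_leaf fun u => ⟨huniq u, fun hu => hu ▸ hw'⟩).trans
    ((Nat.mul_le_mul_left 2 hle).trans (two_mul_M_le n hn))
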